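/- For a finite set $X$ with at least two elements, let $X^*$ be the $X$-regular rooted tree, whose vertices are the finite words over $X$, with $u$ and $ux$ joined by an edge for every word $u$ and every $x \in X$. A subgroup $G$ of the group $\operatorname{Aut}(X^*)$ of graph automorphisms of $X^*$ is called a \emph{branch group} if it acts transitively on the set $X^m$ of words of length $m$ for every $m \geq 0$, and if for every $m \geq 0$ the subgroup $\operatorname{Rist}_G(m) = \prod_{v \in X^m} \operatorname{rist}_G(v)$ has finite index in $G$, where $\operatorname{rist}_G(v)$ consists of the elements of $G$ that fix every vertex not having $v$ as a prefix. \textbf{Theorem.} For every integer $n \geq 0$ there exist a finite set $X$ with at least two elements, a branch group $G \leq \operatorname{Aut}(X^*)$, and a chain of subgroups \[ G_0 \leq G_1 \leq \dots \leq G_n = G \] such that for every $i \in \{1, \dots, n\}$ the group $G_{i-1}$ is a branch group (with respect to its action on the same tree $X^*$) and is a maximal subgroup of infinite index in $G_i$. -/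

import Mathlib

namespace RegularTree

/-- The `X`-regular rooted tree `X^*`: its vertices are the finite words over the alphabet `X`
(the root is the empty word), and `u`, `v` are joined by an edge iff one of them is obtained
from the other by appending one letter. -/
def tree (X : Type*) : SimpleGraph (List X) where
  Adj u v := (∃ x, v = u ++ [x]) ∨ (∃ x, u = v ++ [x])
  symm := ⟨fun _ _ h => h.symm⟩
  loopless := ⟨fun u h => by
    rcases h with ⟨x, hx⟩ | ⟨x, hx⟩ <;> simpa using congrArg List.length hx⟩

/-- The group of all graph automorphisms of the tree `X^*` (the product is composition). -/
abbrev TreeAut (X : Type*) : Type _ := tree X ≃g tree X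

variable {X : Type*}

/-- `G` acts transitively on every layer `X^n`. -/
def IsSphericallyTransitive (G : Subgroup (TreeAut X)) : Prop :=
  ∀ u v : List X, u.length = v.length → ∃ g ∈ G, g u = v

/-- The rigid vertex stabiliser of `v` in `G`: the elements of `G` which act only inside the
subtree `vX^*` of words with prefix `v`, that is, which fix every other vertex. -/
def rigidVertexStabilizer (G : Subgroup (TreeAut X)) (v : List X) : Subgroup (TreeAut X) where
  carrier := {g | g ∈ G ∧ ∀ w : List X, ¬ v <+: w → g w = w}
  mul_mem' := by
    rintro a b ⟨ha, ha'⟩ ⟨hb, hb'⟩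
    refine ⟨G.mul_mem ha hb, fun w hw => ?_⟩
    rw [RelIso.mul_apply, hb' w hw, ha' w hw]
  one_mem' := ⟨G.one_mem, fun _ _ => rfl⟩
  inv_mem' := by
    rintro a ⟨ha, ha'⟩
    refine ⟨G.inv_mem ha, fun w hw => ?_⟩
    conv_lhs => rw [← ha' w hw]
    exact RelIso.inv_apply_self a w

/-- The `n`-th rigid layer stabiliser: the product of the (pairwise commuting) rigid vertex
stabilisers of the vertices of layer `n`. -/
def rigidLayerStabilizer (G : Subgroup (TreeAut X)) (n : ℕ) : Subgroup (TreeAut X) :=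
  ⨆ v : {v : List X // v.length = n}, rigidVertexStabilizer G v.1

/-- A branch group: a spherically transitive group of tree automorphisms all of whose rigid layer
stabilisers have finite index. -/
def IsBranch (G : Subgroup (TreeAut X)) : Prop :=
  IsSphericallyTransitive G ∧
    ∀ n : ℕ, ((rigidLayerStabilizer G n).subgroupOf G).FiniteIndex

end RegularTree

/-! For `H ≤ Sym(X)` let `A(H)` (`almostLetterwise H`) consist of the automorphisms that are
arbitrary down to some layer, and below each of its vertices apply one permutation from `H` to every
remaining letter. Every `A(H)` is branch: it is transitive on layers, and restricting an element to
the subtree of a fixed vertex stays in `A(H)`, so layer stabilisers are products of rigid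
stabilisers.

For `H < K` the index of `A(H)` in `A(K)` is infinite. `A(H)` is maximal as soon as `H` and `hHh⁻¹`
generate `K` for every `h ∈ K \ H`: an intermediate element with a section `h ∉ H` conjugates the
copy of `H` below one vertex to `hHh⁻¹` below its image, so all of `K` appears there, and by
transitivity below every vertex of the layer.

Point stabilisers in symmetric groups of degree at least three satisfy this condition, so `Sym(2) <
Sym(3) < ... < Sym(n+2)` gives the chain. Preservation of length is built into `A(H)`, so no
rigidity of the root is needed. -/

namespace RegularTree

/-! ### Layer-preserving tree automorphisms -/

section Automorphisms

variable {X : Type*}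

/-- Adjacency in the tree for a longer second vertex. -/
theorem tree_adj_of_length {u v : List X} (h : (tree X).Adj u v) (hl : v.length = u.length + 1) :
    ∃ x, v = u ++ [x] := by
  rcases h with h | ⟨x, rfl⟩
  · exact h
  · simp at hl
    omega

/-- A tree automorphism is length preserving if it preserves every layer of the tree. -/
def LengthPreserving (g : TreeAut X) : Prop := ∀ u, (g u).length = u.length

theorem LengthPreserving.one : LengthPreserving (1 : TreeAut X) := fun _ => rfl

theorem LengthPreserving.mul {g h : TreeAut X} (hg : LengthPreserving g)
    (hh : LengthPreserving h) : LengthPreserving (g * h) := fun u => by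
  rw [RelIso.mul_apply, hg, hh]

theorem LengthPreserving.inv {g : TreeAut X} (hg : LengthPreserving g) :
    LengthPreserving g⁻¹ := fun u => by
  rw [← hg, RelIso.apply_inv_self]

theorem LengthPreserving.append_singleton {g : TreeAut X} (hg : LengthPreserving g)
    (u : List X) (x : X) : ∃ y, g (u ++ [x]) = g u ++ [y] :=
  tree_adj_of_length (g.map_rel_iff.2 (Or.inl ⟨x, rfl⟩)) (by simp [hg _])

theorem LengthPreserving.prefix_append {g : TreeAut X} (hg : LengthPreserving g)
    (u w : List X) : g u <+: g (u ++ w) := by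
  induction w using List.reverseRecOn with
  | nil => simp
  | append_singleton w x ih =>
    obtain ⟨y, hy⟩ := hg.append_singleton (u ++ w) x
    rw [← List.append_assoc, hy]
    exact ih.trans (List.prefix_append _ _)

theorem LengthPreserving.isPrefix {g : TreeAut X} (hg : LengthPreserving g)
    {u w : List X} (h : u <+: w) : g u <+: g w := by
  obtain ⟨t, rfl⟩ := h
  exact hg.prefix_append u t

theorem LengthPreserving.isPrefix_iff {g : TreeAut X} (hg : LengthPreserving g)
    {u w : List X} : g u <+: g w ↔ u <+: w :=
  ⟨fun h => by simpa using hg.inv.isPrefix h, hg.isPrefix⟩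

theorem LengthPreserving.take_apply {g : TreeAut X} (hg : LengthPreserving g)
    (m : ℕ) (w : List X) : (g w).take m = g (w.take m) := by
  have h := hg.isPrefix (List.take_prefix m w)
  rw [List.prefix_iff_eq_take.1 h, hg, List.length_take, ← hg w]
  simp

/-- The tree automorphism given by two mutually inverse maps that send children to children. -/
def treeAutOfMaps (f f' : List X → List X) (h₁ : Function.LeftInverse f' f)
    (h₂ : Function.RightInverse f' f) (hf : ∀ u x, ∃ y, f (u ++ [x]) = f u ++ [y])
    (hf' : ∀ u x, ∃ y, f' (u ++ [x]) = f' u ++ [y]) : TreeAut X where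
  toFun := f
  invFun := f'
  left_inv := h₁
  right_inv := h₂
  map_rel_iff' := by
    have key : ∀ k : List X → List X, (∀ u x, ∃ y, k (u ++ [x]) = k u ++ [y]) →
        ∀ u v, (tree X).Adj u v → (tree X).Adj (k u) (k v) := by
      rintro k hk u v (⟨x, rfl⟩ | ⟨x, rfl⟩)
      · exact Or.inl (hk u x)
      · exact Or.inr (hk v x)
    intro u v
    refine ⟨fun h => ?_, key f hf u v⟩
    have := key f' hf' _ _ h
    simpa [h₁ u, h₁ v] using this

end Automorphisms

/-! ### Prescribing sections and restricting to subtrees -/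

section Grafting

variable {X : Type*}

/-- The map acting as `g` on words of length `m` and as the letterwise action of `s v` below the
vertex `v` of layer `m`. -/
def graftFun (g : TreeAut X) (m : ℕ) (s : List X → Equiv.Perm X) (w : List X) : List X :=
  g (w.take m) ++ (w.drop m).map (s (w.take m))

theorem graftFun_append_singleton {g : TreeAut X} (hg : LengthPreserving g) (m : ℕ)
    (s : List X → Equiv.Perm X) (u : List X) (x : X) :
    ∃ y, graftFun g m s (u ++ [x]) = graftFun g m s u ++ [y] := by
  unfold graftFun
  rcases le_or_gt m u.length with h | h
  · refine ⟨s (u.take m) x, ?_⟩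
    simp [List.take_append_of_le_length h, List.drop_append_of_le_length h]
  · obtain ⟨y, hy⟩ := hg.append_singleton u x
    refine ⟨y, ?_⟩
    rw [List.take_of_length_le (by simp; omega), List.drop_of_length_le (by simp; omega),
      List.take_of_length_le h.le, List.drop_of_length_le h.le]
    simp [hy]

/-- The wreath product multiplication rule; inverses, multiplicativity of `diagonal` and the
conjugation formula are instances of it. -/
theorem graftFun_graftFun {g g' : TreeAut X} (hg : LengthPreserving g) (m : ℕ)
    (s s' : List X → Equiv.Perm X) (w : List X) :
    graftFun g' m s' (graftFun g m s w) = graftFun (g' * g) m (fun v => s' (g v) * s v) w := by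
  unfold graftFun
  rcases le_or_gt m w.length with h | h
  · have hl : (g (w.take m)).length = m := by rw [hg]; simpa using h
    rw [List.take_left' hl, List.drop_left' hl]
    simp
  · have hl : (g w).length ≤ m := by rw [hg]; exact h.le
    simp [List.take_of_length_le h.le, List.drop_of_length_le h.le, List.take_of_length_le hl,
      List.drop_of_length_le hl]

theorem graftFun_one_one (m : ℕ) (w : List X) :
    graftFun (1 : TreeAut X) m (fun _ => 1) w = w := by
  simp [graftFun]

/-- The automorphism acting as `g` on words of length `m` and as the letterwise action of `s v`
below the vertex `v` of layer `m`. -/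
def graft (g : TreeAut X) (hg : LengthPreserving g) (m : ℕ) (s : List X → Equiv.Perm X) :
    TreeAut X :=
  treeAutOfMaps (graftFun g m s) (graftFun g⁻¹ m fun v => (s (g⁻¹ v))⁻¹)
    (fun w => by rw [graftFun_graftFun hg]; simpa using graftFun_one_one m w)
    (fun w => by rw [graftFun_graftFun hg.inv]; simpa using graftFun_one_one m w)
    (graftFun_append_singleton hg m s) (graftFun_append_singleton hg.inv m _)

theorem graft_apply (g : TreeAut X) (hg : LengthPreserving g) (m : ℕ)
    (s : List X → Equiv.Perm X) (w : List X) :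
    graft g hg m s w = g (w.take m) ++ (w.drop m).map (s (w.take m)) := rfl

theorem graft_apply_append (g : TreeAut X) (hg : LengthPreserving g) {m : ℕ}
    (s : List X → Equiv.Perm X) {v : List X} (hv : v.length = m) (w : List X) :
    graft g hg m s (v ++ w) = g v ++ w.map (s v) := by
  rw [graft_apply, List.take_left' hv, List.drop_left' hv]

theorem LengthPreserving.graft {g : TreeAut X} (hg : LengthPreserving g) (m : ℕ)
    (s : List X → Equiv.Perm X) : LengthPreserving (graft g hg m s) := fun w => by
  rw [graft_apply, List.length_append, hg, List.length_map, ← List.length_append,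
    List.take_append_drop]

/-- Families of permutations act letterwise below the vertices of layer `m`. -/
def diagonal (X : Type*) (m : ℕ) : (List X → Equiv.Perm X) →* TreeAut X where
  toFun s := graft 1 .one m s
  map_one' := RelIso.ext fun w => graftFun_one_one m w
  map_mul' s t := RelIso.ext fun w => by
    symm
    exact graftFun_graftFun .one m t s w

theorem diagonal_apply (m : ℕ) (s : List X → Equiv.Perm X) (w : List X) :
    diagonal X m s w = w.take m ++ (w.drop m).map (s (w.take m)) := rfl

theorem diagonal_apply_append {m : ℕ} (s : List X → Equiv.Perm X) {v : List X}
    (hv : v.length = m) (w : List X) : diagonal X m s (v ++ w) = v ++ w.map (s v) :=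
  graft_apply_append 1 .one s hv w

theorem diagonal_apply_of_length_le {m : ℕ} (s : List X → Equiv.Perm X) {w : List X}
    (hw : w.length ≤ m) : diagonal X m s w = w := by
  rw [diagonal_apply, List.take_of_length_le hw, List.drop_of_length_le hw]
  simp

open Classical in
/-- The automorphism acting as `g` below the fixed vertex `v` and trivially elsewhere. -/
noncomputable def restrict (g : TreeAut X) (hg : LengthPreserving g) (v : List X) (hv : g v = v) :
    TreeAut X :=
  have hp : ∀ k : TreeAut X, LengthPreserving k → k v = v → ∀ w, v <+: k w ↔ v <+: w :=
    fun k hk hkv w => by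
      have := hk.isPrefix_iff (u := v) (w := w)
      rwa [hkv] at this
  have hv' : g⁻¹ v = v := by
    conv_lhs => rw [← hv]
    exact RelIso.inv_apply_self g v
  have hc : ∀ k : TreeAut X, LengthPreserving k → k v = v → ∀ u x, ∃ y,
      (if v <+: u ++ [x] then k (u ++ [x]) else u ++ [x]) =
        (if v <+: u then k u else u) ++ [y] := fun k hk hkv u x => by
    by_cases h : v <+: u
    · rw [if_pos h, if_pos (h.trans (List.prefix_append _ _))]
      exact hk.append_singleton u x
    · rw [if_neg h]
      by_cases h' : v <+: u ++ [x]
      · rw [if_pos h']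
        rcases List.prefix_concat_iff.1 h' with rfl | h'
        · exact ⟨x, hkv⟩
        · exact absurd h' h
      · exact ⟨x, if_neg h'⟩
  treeAutOfMaps (fun w => if v <+: w then g w else w) (fun w => if v <+: w then g⁻¹ w else w)
    (fun w => by
      by_cases h : v <+: w
      · simp [h, hp g hg hv]
      · simp [h])
    (fun w => by
      by_cases h : v <+: w
      · simp [h, hp _ hg.inv hv']
      · simp [h])
    (hc g hg hv) (hc _ hg.inv hv')

theorem restrict_apply_of_prefix {g : TreeAut X} (hg : LengthPreserving g) {v w : List X}
    (hv : g v = v) (h : v <+: w) : restrict g hg v hv w = g w := if_pos h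

theorem restrict_apply_of_not_prefix {g : TreeAut X} (hg : LengthPreserving g) {v w : List X}
    (hv : g v = v) (h : ¬ v <+: w) : restrict g hg v hv w = w := if_neg h

theorem LengthPreserving.restrict {g : TreeAut X} (hg : LengthPreserving g) {v : List X}
    (hv : g v = v) : LengthPreserving (restrict g hg v hv) := fun w => by
  by_cases h : v <+: w
  · rw [restrict_apply_of_prefix hg hv h, hg]
  · rw [restrict_apply_of_not_prefix hg hv h]

end Grafting

/-! ### The groups `A(H)`: branching, maximality, infinite index -/

section AlmostLetterwise

variable {X : Type*}

/-- Below every vertex of layer `m` the automorphism `g` acts letterwise, by elements of `H`. -/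
def IsLetterwiseBelow (H : Subgroup (Equiv.Perm X)) (m : ℕ) (g : TreeAut X) : Prop :=
  ∀ v : List X, v.length = m → ∃ h ∈ H, ∀ w, g (v ++ w) = g v ++ w.map h

theorem IsLetterwiseBelow.mono {H : Subgroup (Equiv.Perm X)} {m k : ℕ} (hmk : m ≤ k)
    {g : TreeAut X} (hg : IsLetterwiseBelow H m g) : IsLetterwiseBelow H k g := by
  intro v hv
  obtain ⟨h, hh, hw⟩ := hg (v.take m) (by simp; omega)
  refine ⟨h, hh, fun w => ?_⟩
  have h₁ := hw (v.drop m ++ w)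
  have h₂ := hw (v.drop m)
  rw [← List.append_assoc, List.take_append_drop] at h₁
  rw [List.take_append_drop] at h₂
  rw [h₁, h₂]
  simp

/-- The group of the automorphisms that act letterwise, by elements of `H`, below all vertices of
some layer. -/
def almostLetterwise (H : Subgroup (Equiv.Perm X)) : Subgroup (TreeAut X) where
  carrier := {g | LengthPreserving g ∧ ∃ m, IsLetterwiseBelow H m g}
  one_mem' := ⟨.one, 0, fun v _ => ⟨1, H.one_mem, fun w => by simp⟩⟩
  mul_mem' := by
    rintro a b ⟨ha, m, hma⟩ ⟨hb, k, hkb⟩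
    refine ⟨ha.mul hb, max m k, fun v hv => ?_⟩
    obtain ⟨h, hh, hw⟩ := hkb.mono (le_max_right m k) v hv
    obtain ⟨h', hh', hw'⟩ := hma.mono (le_max_left m k) (b v) ((hb v).trans hv)
    refine ⟨h' * h, H.mul_mem hh' hh, fun w => ?_⟩
    rw [RelIso.mul_apply, hw, hw', RelIso.mul_apply, List.map_map]
    rfl
  inv_mem' := by
    rintro a ⟨ha, m, hma⟩
    refine ⟨ha.inv, m, fun v hv => ?_⟩
    obtain ⟨h, hh, hw⟩ := hma (a⁻¹ v) ((ha.inv v).trans hv)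
    refine ⟨h⁻¹, H.inv_mem hh, fun w => ?_⟩
    apply a.injective
    rw [RelIso.apply_inv_self, hw, RelIso.apply_inv_self, List.map_map]
    congr 1
    symm
    convert List.map_id w
    ext x
    simp

theorem lengthPreserving_of_mem {H : Subgroup (Equiv.Perm X)} {g : TreeAut X}
    (hg : g ∈ almostLetterwise H) : LengthPreserving g := hg.1

theorem graft_mem {H : Subgroup (Equiv.Perm X)} {g : TreeAut X} (hg : LengthPreserving g) {m : ℕ}
    {s : List X → Equiv.Perm X} (hs : ∀ v, s v ∈ H) : graft g hg m s ∈ almostLetterwise H := by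
  refine ⟨hg.graft m s, m, fun v hv => ⟨s v, hs v, fun w => ?_⟩⟩
  rw [graft_apply_append g hg s hv]
  congr 1
  simpa using (graft_apply_append g hg s hv []).symm

theorem almostLetterwise_mono {H K : Subgroup (Equiv.Perm X)} (h : H ≤ K) :
    almostLetterwise H ≤ almostLetterwise K := by
  rintro g ⟨hg, m, hm⟩
  refine ⟨hg, m, fun v hv => ?_⟩
  obtain ⟨a, ha, hw⟩ := hm v hv
  exact ⟨a, h ha, hw⟩

theorem mulSingle_mem [DecidableEq (List X)] {H : Subgroup (Equiv.Perm X)} (v : List X)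
    {a : Equiv.Perm X} (ha : a ∈ H) (u : List X) :
    (Pi.mulSingle v a : List X → Equiv.Perm X) u ∈ H := by
  by_cases h : u = v
  · subst h
    simpa using ha
  · simp [Pi.mulSingle_eq_of_ne h, H.one_mem]

theorem isSphericallyTransitive_almostLetterwise (H : Subgroup (Equiv.Perm X)) :
    IsSphericallyTransitive (almostLetterwise H) := by
  classical
  intro u
  induction u using List.reverseRecOn with
  | nil =>
    intro v hv
    exact ⟨1, one_mem _, by simpa using (List.length_eq_zero_iff.1 hv.symm).symm⟩
  | append_singleton u x ih =>
    intro v hv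
    rcases List.eq_nil_or_concat' v with rfl | ⟨v, y, rfl⟩
    · simp at hv
    obtain ⟨g, hg, hguv⟩ := ih v (by simpa using hv)
    have hgl := lengthPreserving_of_mem hg
    obtain ⟨z, hz⟩ := hgl.append_singleton u x
    -- The swap need not lie in `H`, so it is cut off one layer further down by grafting trivial
    -- sections.
    have hd : LengthPreserving (diagonal X v.length fun _ => Equiv.swap z y) :=
      LengthPreserving.one.graft _ _
    refine ⟨graft _ hd (v.length + 1) (fun _ => 1) * g,
      mul_mem (graft_mem hd fun _ => one_mem H) hg, ?_⟩
    have := graft_apply_append _ hd (fun _ => 1) (v := v ++ [z]) (m := v.length + 1) (by simp) []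
    rw [RelIso.mul_apply, hz, hguv]
    simpa [diagonal_apply_append] using this

theorem restrict_mem {H : Subgroup (Equiv.Perm X)} {g : TreeAut X}
    (hg : g ∈ almostLetterwise H) {v : List X} (hv : g v = v) :
    restrict g hg.1 v hv ∈ almostLetterwise H := by
  obtain ⟨m, hm⟩ := hg.2
  -- At depth at least `v.length` each subtree lies entirely inside or entirely outside that of `v`.
  refine ⟨hg.1.restrict hv, max m v.length, fun u hu => ?_⟩
  have hvu : v.length ≤ u.length := hu ▸ le_max_right _ _
  by_cases h : v <+: u
  · obtain ⟨a, ha, hw⟩ := hm.mono (le_max_left m v.length) u hu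
    refine ⟨a, ha, fun w => ?_⟩
    rw [restrict_apply_of_prefix hg.1 hv (h.trans (List.prefix_append _ _)),
      restrict_apply_of_prefix hg.1 hv h, hw]
  · refine ⟨1, H.one_mem, fun w => ?_⟩
    have h' : ¬ v <+: u ++ w := fun h' =>
      h (List.prefix_of_prefix_length_le h' (List.prefix_append _ _) hvu)
    rw [restrict_apply_of_not_prefix hg.1 hv h', restrict_apply_of_not_prefix hg.1 hv h]
    simp

/-- Splits an element of the layer stabiliser into rigid factors, peeling off one supporting vertex
at a time. With `S` the whole layer, the layer stabiliser is rigid. -/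
theorem mem_rigidLayerStabilizer_of_supported {H : Subgroup (Equiv.Perm X)} {m : ℕ}
    (S : Finset (List X)) (hS : ∀ v ∈ S, v.length = m) :
    ∀ g ∈ almostLetterwise H, (∀ v : List X, v.length = m → g v = v) →
      (∀ w, (∀ v ∈ S, ¬ v <+: w) → g w = w) →
      g ∈ rigidLayerStabilizer (almostLetterwise H) m := by
  classical
  induction S using Finset.induction_on with
  | empty =>
    intro g _ _ h
    have : g = 1 := RelIso.ext fun w => h w (by simp)
    exact this ▸ one_mem _
  | insert v S hvS ih =>
    intro g hg hfix hsupp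
    have hvl := hS v (Finset.mem_insert_self _ _)
    have hv : g v = v := hfix v hvl
    set r := restrict g hg.1 v hv with hr
    have hrm : r ∈ almostLetterwise H := restrict_mem hg hv
    have hrr : r ∈ rigidLayerStabilizer (almostLetterwise H) m :=
      (le_iSup (fun u : {u : List X // u.length = m} =>
        rigidVertexStabilizer (almostLetterwise H) u.1) ⟨v, hvl⟩)
        ⟨hrm, fun w hw => restrict_apply_of_not_prefix hg.1 hv hw⟩
    have hpre : ∀ w, v <+: w → (r⁻¹ * g) w = w := fun w hw => by
      rw [RelIso.mul_apply, ← restrict_apply_of_prefix hg.1 hv hw]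
      exact RelIso.inv_apply_self r w
    have hnpre : ∀ w, ¬ v <+: w → g w = w → (r⁻¹ * g) w = w := fun w hw hgw => by
      rw [RelIso.mul_apply, hgw]
      conv_lhs => rw [← restrict_apply_of_not_prefix hg.1 hv hw]
      exact RelIso.inv_apply_self r w
    have key : r⁻¹ * g ∈ rigidLayerStabilizer (almostLetterwise H) m := by
      refine ih (fun u hu => hS u (Finset.mem_insert_of_mem hu)) _
        (mul_mem (inv_mem hrm) hg) (fun u hu => ?_) (fun w hw => ?_)
      · by_cases h : v <+: u
        · exact hpre u h
        · exact hnpre u h (hfix u hu)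
      · by_cases h : v <+: w
        · exact hpre w h
        · refine hnpre w h (hsupp w fun u hu => ?_)
          rcases Finset.mem_insert.1 hu with rfl | hu
          · exact h
          · exact hw u hu
    simpa using mul_mem hrr key

theorem isBranch_almostLetterwise [Finite X] [Nonempty X] (H : Subgroup (Equiv.Perm X)) :
    IsBranch (almostLetterwise H) := by
  refine ⟨isSphericallyTransitive_almostLetterwise H, fun m => ?_⟩
  have hfin := List.finite_length_eq X m
  have : Finite {v : List X // v.length = m} := hfin
  let R := (rigidLayerStabilizer (almostLetterwise H) m).subgroupOf (almostLetterwise H)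
  let φ : almostLetterwise H → {v : List X // v.length = m} → {v : List X // v.length = m} :=
    fun g v => ⟨g.1 v.1, (g.2.1 v.1).trans v.2⟩
  have hφ : ∀ a b, φ a = φ b → a⁻¹ * b ∈ R := by
    intro a b hab
    rw [Subgroup.mem_subgroupOf]
    have hfix : ∀ v : List X, v.length = m → (a⁻¹ * b : TreeAut X) v = v := fun v hv => by
      have : a.1 v = b.1 v := congrArg Subtype.val (congrFun hab ⟨v, hv⟩)
      rw [RelIso.mul_apply, ← this]
      exact RelIso.inv_apply_self a.1 v
    have hmem := (a⁻¹ * b).2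
    refine mem_rigidLayerStabilizer_of_supported hfin.toFinset (fun v hv => by simpa using hv)
      _ hmem hfix fun w hw => ?_
    rcases le_or_gt m w.length with h | h
    · exact absurd (List.take_prefix m w) (hw _ (by simpa using h))
    -- A word above layer `m` is fixed because an extension of it to length `m` is.
    · obtain ⟨x⟩ := ‹Nonempty X›
      have h₁ := hfix (w ++ List.replicate (m - w.length) x) (by simp; omega)
      have h₂ := (lengthPreserving_of_mem hmem).take_apply w.length
        (w ++ List.replicate (m - w.length) x)
      rw [List.take_left] at h₂
      exact h₂.symm.trans ((congrArg (List.take w.length) h₁).trans List.take_left)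
  have : Finite (almostLetterwise H ⧸ R) := by
    refine Finite.of_injective (fun q => φ q.out) fun p q hpq => ?_
    have := hφ _ _ hpq
    rw [← QuotientGroup.eq] at this
    simpa using this
  exact Subgroup.finiteIndex_of_finite_quotient

theorem eq_graft_of_isLetterwiseBelow {H : Subgroup (Equiv.Perm X)} {g : TreeAut X}
    (hg : LengthPreserving g) {m : ℕ} (hm : IsLetterwiseBelow H m g) :
    ∃ s : List X → Equiv.Perm X, (∀ v, s v ∈ H) ∧ g = graft g hg m s := by
  classical
  have : ∀ v : List X, ∃ h ∈ H, v.length = m → ∀ w, g (v ++ w) = g v ++ w.map h := fun v => by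
    by_cases hv : v.length = m
    · obtain ⟨h, hh, hw⟩ := hm v hv
      exact ⟨h, hh, fun _ => hw⟩
    · exact ⟨1, H.one_mem, fun h => absurd h hv⟩
  choose s hs hsw using this
  refine ⟨s, hs, RelIso.ext fun w => ?_⟩
  rw [graft_apply]
  rcases le_or_gt m w.length with h | h
  · rw [← hsw (w.take m) (by simpa using h), List.take_append_drop]
  · simp [List.take_of_length_le h.le, List.drop_of_length_le h.le]

theorem graft_eq_mul_diagonal {g : TreeAut X} (hg : LengthPreserving g) (m : ℕ)
    (s : List X → Equiv.Perm X) :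
    graft g hg m s = graft g hg m (fun _ => 1) * diagonal X m s := by
  refine RelIso.ext fun w => ?_
  have := graftFun_graftFun (g := 1) (g' := g) .one m s (fun _ => 1) w
  simp only [mul_one, one_mul] at this
  exact this.symm

/-- Conjugation moves a letterwise action below `v` to a letterwise action below `g v`. -/
theorem graft_mul_diagonal_mulSingle [DecidableEq (List X)] {g : TreeAut X}
    (hg : LengthPreserving g) {m : ℕ} (s : List X → Equiv.Perm X) (v : List X)
    (a : Equiv.Perm X) :
    graft g hg m s * diagonal X m (Pi.mulSingle v a) * (graft g hg m s)⁻¹ =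
      diagonal X m (Pi.mulSingle (g v) (s v * a * (s v)⁻¹)) := by
  rw [mul_inv_eq_iff_eq_mul]
  refine RelIso.ext fun w => ?_
  have h₁ := graftFun_graftFun (g := 1) (g' := g) .one m (Pi.mulSingle v a) s w
  have h₂ := graftFun_graftFun (g := g) (g' := 1) hg m s
    (Pi.mulSingle (g v) (s v * a * (s v)⁻¹)) w
  refine h₁.trans (Eq.trans ?_ h₂.symm)
  congr 1
  funext u
  by_cases h : u = v
  · subst h
    simp
  · simp [Pi.mulSingle_eq_of_ne h, Pi.mulSingle_eq_of_ne (g.injective.ne h)]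

/-- The core of maximality: one section outside `H` produces all of `K` below one vertex, then below
the whole layer. -/
theorem eq_almostLetterwise_of_lt [Finite X] {H K : Subgroup (Equiv.Perm X)}
    (hgen : ∀ h ∈ K, h ∉ H → ∀ L : Subgroup (Equiv.Perm X), H ≤ L →
      (∀ a ∈ H, h * a * h⁻¹ ∈ L) → K ≤ L)
    {M : Subgroup (TreeAut X)} (hM : almostLetterwise H < M) (hMK : M ≤ almostLetterwise K) :
    M = almostLetterwise K := by
  classical
  refine le_antisymm hMK fun k hk => ?_
  obtain ⟨g, hgM, hgH⟩ := SetLike.exists_of_lt hM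
  obtain ⟨hgl, m₁, hm₁⟩ := hMK hgM
  obtain ⟨hkl, m₂, hm₂⟩ := hk
  set m := max m₁ m₂ with hm
  obtain ⟨s, hs, hgs⟩ := eq_graft_of_isLetterwiseBelow hgl (hm₁.mono (le_max_left m₁ m₂))
  obtain ⟨t, ht, hkt⟩ := eq_graft_of_isLetterwiseBelow hkl (hm₂.mono (le_max_right m₁ m₂))
  rw [← hm] at hgs hkt
  obtain ⟨v, hv, hsv⟩ : ∃ v : List X, v.length = m ∧ s v ∉ H := by
    by_contra! hcon
    refine hgH ⟨hgl, m, fun v hv => ⟨s v, hcon v hv, fun w => ?_⟩⟩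
    have := graft_apply_append g hgl s hv w
    rwa [← hgs] at this
  have hdiag : ∀ (u : List X) (a : Equiv.Perm X), a ∈ H →
      diagonal X m (Pi.mulSingle u a) ∈ M := fun u a ha =>
    hM.le (graft_mem .one (mulSingle_mem u ha))
  have hone : ∀ a ∈ K, diagonal X m (Pi.mulSingle (g v) a) ∈ M := by
    have := hgen (s v) (hs v) hsv
      (M.comap ((diagonal X m).comp (MonoidHom.mulSingle (fun _ : List X => Equiv.Perm X) (g v))))
      (fun a ha => hdiag _ a ha) (fun a ha => ?_)
    · exact fun a ha => this ha
    · have hc := graft_mul_diagonal_mulSingle hgl (m := m) s v a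
      rw [← hgs] at hc
      have : diagonal X m (Pi.mulSingle (g v) (s v * a * (s v)⁻¹)) ∈ M :=
        hc ▸ mul_mem (mul_mem hgM (hdiag v a ha)) (inv_mem hgM)
      exact this
  have hall : ∀ u : List X, u.length = m → ∀ a ∈ K, diagonal X m (Pi.mulSingle u a) ∈ M := by
    intro u hu a ha
    obtain ⟨f, hf, hfu⟩ := isSphericallyTransitive_almostLetterwise H (g v) u
      (by rw [hgl, hv, hu])
    have hfl := lengthPreserving_of_mem hf
    -- Trivial sections let conjugation transport `a` from `g v` to `u` unchanged.
    have hfM : graft f hfl m (fun _ => 1) ∈ M := hM.le (graft_mem hfl fun _ => one_mem H)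
    have hc := graft_mul_diagonal_mulSingle hfl (m := m) (fun _ => 1) (g v) a
    rw [hfu] at hc
    simp only [one_mul, inv_one, mul_one] at hc
    exact hc ▸ mul_mem (mul_mem hfM (hone a ha)) (inv_mem hfM)
  have hfin := List.finite_length_eq X m
  have htM : diagonal X m t ∈ M := by
    -- Only values on layer `m` matter; cutting off elsewhere makes the family finitely supported.
    let t' : List X → Equiv.Perm X := fun u => if u.length = m then t u else 1
    have htt' : diagonal X m t = diagonal X m t' := RelIso.ext fun w => by
      rcases le_or_gt m w.length with h | h
      · have : t' (w.take m) = t (w.take m) := if_pos (by simpa using h)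
        rw [diagonal_apply, diagonal_apply, this]
      · rw [diagonal_apply_of_length_le _ h.le, diagonal_apply_of_length_le _ h.le]
    rw [htt']
    refine Submonoid.pi_mem_of_mulSingle_mem_aux hfin.toFinset (H := M.comap (diagonal X m)) t'
      (fun u hu => if_neg (by simpa using hu)) fun u hu => ?_
    have hu : u.length = m := by simpa using hu
    have : t' u = t u := if_pos hu
    rw [this]
    exact hall u hu _ (ht u)
  rw [hkt, graft_eq_mul_diagonal]
  exact mul_mem (hM.le (graft_mem hkl fun _ => one_mem H)) htM

theorem isCoatom_almostLetterwise [Finite X] {H K : Subgroup (Equiv.Perm X)} (hHK : H ≤ K)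
    (hgen : ∀ h ∈ K, h ∉ H → ∀ L : Subgroup (Equiv.Perm X), H ≤ L →
      (∀ a ∈ H, h * a * h⁻¹ ∈ L) → K ≤ L)
    (hinf : ¬ ((almostLetterwise H).subgroupOf (almostLetterwise K)).FiniteIndex) :
    IsCoatom ((almostLetterwise H).subgroupOf (almostLetterwise K)) := by
  refine ⟨fun h => hinf (h ▸ inferInstance), fun B hB => ?_⟩
  have hmap : ((almostLetterwise H).subgroupOf (almostLetterwise K)).map
      (almostLetterwise K).subtype = almostLetterwise H :=
    Subgroup.map_subgroupOf_eq_of_le (almostLetterwise_mono hHK)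
  have hlt : almostLetterwise H < B.map (almostLetterwise K).subtype := by
    rw [← hmap]
    exact (Subgroup.map_lt_map_iff_of_injective (Subgroup.subtype_injective _)).2 hB
  have := eq_almostLetterwise_of_lt hgen hlt (Subgroup.map_subtype_le B)
  refine eq_top_iff.2 fun x _ => ?_
  have hx : (x : TreeAut X) ∈ B.map (almostLetterwise K).subtype := by
    rw [this]
    exact x.2
  obtain ⟨y, hy, hyx⟩ := hx
  have : y = x := Subtype.ext hyx
  exact this ▸ hy

/-- The elements `t j`, acting by `h` below `x^j`, lie in distinct cosets: for `i < j`, below words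
leaving the ray of `x`'s just after `x^i`, `t i` acts by `h` while `t j` is trivial. -/
theorem not_finiteIndex_almostLetterwise [Nontrivial X] {H K : Subgroup (Equiv.Perm X)}
    {h : Equiv.Perm X} (hK : h ∈ K) (hH : h ∉ H) :
    ¬ ((almostLetterwise H).subgroupOf (almostLetterwise K)).FiniteIndex := by
  classical
  intro hfi
  obtain ⟨x, y, hxy⟩ := exists_pair_ne X
  let t : ℕ → almostLetterwise K := fun j =>
    ⟨diagonal X j (Pi.mulSingle (List.replicate j x) h), graft_mem .one (mulSingle_mem _ hK)⟩
  have key : ∀ i j, i < j →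
      (QuotientGroup.mk (t j) : _ ⧸ (almostLetterwise H).subgroupOf (almostLetterwise K)) ≠
        QuotientGroup.mk (t i) := by
    intro i j hij heq
    have hmem : (t j).1⁻¹ * (t i).1 ∈ almostLetterwise H := by
      simpa [QuotientGroup.eq, Subgroup.mem_subgroupOf] using heq
    have hfix : ∀ w : List X, (t j).1⁻¹ (List.replicate i x ++ y :: w) =
        List.replicate i x ++ y :: w := fun w => by
      have hne : (List.replicate i x ++ y :: w).take j ≠ List.replicate j x := fun e => by
        have hpre : List.replicate j x <+: List.replicate i x ++ y :: w :=
          e ▸ List.take_prefix _ _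
        obtain ⟨d, rfl⟩ := Nat.exists_eq_add_of_lt hij
        rw [add_assoc, List.replicate_add, List.prefix_append_right_inj,
          List.replicate_succ, List.cons_prefix_cons] at hpre
        exact hxy hpre.1
      have : (t j).1 (List.replicate i x ++ y :: w) = List.replicate i x ++ y :: w := by
        refine (diagonal_apply _ _ _).trans ?_
        rw [Pi.mulSingle_eq_of_ne hne]
        simp
      conv_lhs => rw [← this]
      exact RelIso.inv_apply_self (t j).1 _
    have happ : ∀ w : List X,
        ((t j).1⁻¹ * (t i).1) (List.replicate i x ++ h⁻¹ y :: w) =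
          List.replicate i x ++ y :: w.map h := fun w => by
      rw [RelIso.mul_apply, ← hfix]
      congr 1
      refine (diagonal_apply_append _ (List.length_replicate ..) _).trans ?_
      simp
    obtain ⟨-, m, hm⟩ := hmem
    -- The letter `h⁻¹ y` is sent to `y`, off the ray; the tail only makes `v` at least `m` long.
    let v := List.replicate i x ++ h⁻¹ y :: List.replicate m x
    obtain ⟨a, ha, hw⟩ := hm.mono (k := v.length) (by simp [v]; omega) v rfl
    refine hH ?_
    convert ha
    ext z
    have := hw [z]
    simp only [v, List.append_assoc, List.cons_append, happ, List.map_append] at this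
    simpa using this
  obtain ⟨i, j, hne, heq⟩ := Finite.exists_ne_map_eq_of_infinite
    fun j => (QuotientGroup.mk (t j) :
      almostLetterwise K ⧸ (almostLetterwise H).subgroupOf (almostLetterwise K))
  rcases lt_or_gt_of_ne hne with h' | h'
  · exact key i j h' heq.symm
  · exact key j i h' heq

end AlmostLetterwise

/-! ### Nested symmetric groups -/

section Chain

/-- The permutations of `Fin N` that fix all elements which are at least `k`. -/
def fixingAbove (N k : ℕ) : Subgroup (Equiv.Perm (Fin N)) where
  carrier := {σ | ∀ j : Fin N, k ≤ j → σ j = j}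
  one_mem' := fun _ _ => rfl
  mul_mem' := fun {a b} ha hb j hj => by
    rw [Equiv.Perm.mul_apply, hb j hj, ha j hj]
  inv_mem' := fun {a} ha j hj => by
    rw [Equiv.Perm.inv_eq_iff_eq, ha j hj]

theorem fixingAbove_mono {N k l : ℕ} (h : k ≤ l) : fixingAbove N k ≤ fixingAbove N l :=
  fun _ hσ j hj => hσ j (h.trans hj)

theorem swap_mem_fixingAbove {N k : ℕ} {a b : Fin N} (ha : (a : ℕ) < k) (hb : (b : ℕ) < k) :
    Equiv.swap a b ∈ fixingAbove N k := fun j hj =>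
  Equiv.swap_apply_of_ne_of_ne (by rintro rfl; omega) (by rintro rfl; omega)

theorem mem_fixingAbove_of_apply_eq {N k : ℕ} (hk : k < N) {σ : Equiv.Perm (Fin N)}
    (hσ : σ ∈ fixingAbove N (k + 1)) (h : σ ⟨k, hk⟩ = ⟨k, hk⟩) : σ ∈ fixingAbove N k := by
  intro j hj
  rcases hj.eq_or_lt with hj | hj
  · have : j = ⟨k, hk⟩ := Fin.ext hj.symm
    rw [this, h]
  · exact hσ j hj

theorem apply_lt_of_mem_fixingAbove {N k : ℕ} {σ : Equiv.Perm (Fin N)}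
    (hσ : σ ∈ fixingAbove N k) {j : Fin N} (hj : (j : ℕ) < k) : (σ j : ℕ) < k := by
  by_contra! h
  have := σ.injective (hσ _ h)
  rw [this] at h
  omega

/-- A point stabiliser in a symmetric group of degree at least three generates the whole group
together with any other of its conjugates. -/
theorem fixingAbove_succ_le {N k : ℕ} (hk : k < N) (hk2 : 2 ≤ k) {h : Equiv.Perm (Fin N)}
    (hh : h ∈ fixingAbove N (k + 1)) (hh' : h ∉ fixingAbove N k)
    {L : Subgroup (Equiv.Perm (Fin N))} (hL : fixingAbove N k ≤ L)
    (hL' : ∀ a ∈ fixingAbove N k, h * a * h⁻¹ ∈ L) : fixingAbove N (k + 1) ≤ L := by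
  set p : Fin N := ⟨k, hk⟩ with hp
  have hpk : (p : ℕ) = k := rfl
  have hne : h p ≠ p := fun e => hh' (mem_fixingAbove_of_apply_eq hk hh e)
  have hlt : ∀ σ ∈ fixingAbove N (k + 1), σ p ≠ p → (σ p : ℕ) < k := fun σ hσ hσp => by
    have h₁ := apply_lt_of_mem_fixingAbove hσ (j := p) (by omega)
    have h₂ : (σ p : ℕ) ≠ k := fun e => hσp (Fin.ext e)
    omega
  -- The conjugate by `h` of the stabiliser of `p` is the stabiliser of `h p`.
  have hconj : ∀ τ ∈ fixingAbove N (k + 1), τ (h p) = h p → τ ∈ L := fun τ hτ hτp => by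
    have := hL' (h⁻¹ * τ * h) (mem_fixingAbove_of_apply_eq hk
      (mul_mem (mul_mem (inv_mem hh) hτ) hh) (by simp [← hp, hτp]))
    simpa [mul_assoc] using this
  have hmain : ∀ σ ∈ fixingAbove N (k + 1), σ p ≠ h p → σ ∈ L := fun σ hσ hσp => by
    by_cases hσk : σ p = p
    · exact hL (mem_fixingAbove_of_apply_eq hk hσ hσk)
    · have hlt' := hlt σ hσ hσk
      -- This swap fixes `h p`, and multiplying by it makes `σ` fix `p`.
      have hsw : Equiv.swap p (σ p) ∈ fixingAbove N (k + 1) :=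
        swap_mem_fixingAbove (by omega) (by omega)
      have h₁ := hconj _ hsw (Equiv.swap_apply_of_ne_of_ne hne hσp.symm)
      have h₂ : Equiv.swap p (σ p) * σ ∈ L :=
        hL (mem_fixingAbove_of_apply_eq hk (mul_mem hsw hσ) (by simp [← hp]))
      exact (L.mul_mem_cancel_left h₁).1 h₂
  intro σ hσ
  by_cases hσp : σ p = h p
  · have ha := hlt h hh hne
    -- Here `2 ≤ k` is essential: a second point below `k` lets a swap move `σ p` off `h p`. For `k
    -- = 1` the claim fails, the stabiliser being trivial.
    obtain ⟨c, hck, hca⟩ : ∃ c : Fin N, (c : ℕ) < k ∧ c ≠ h p := by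
      by_cases h0 : (h p : ℕ) = 0
      · exact ⟨⟨1, by omega⟩, by simp; omega, fun e => by
          have := congrArg Fin.val e
          simp at this
          omega⟩
      · exact ⟨⟨0, by omega⟩, by simp; omega, fun e => h0 (by rw [← e])⟩
    have hsw : Equiv.swap (h p) c ∈ fixingAbove N k := swap_mem_fixingAbove ha hck
    refine (L.mul_mem_cancel_left (hL hsw)).1
      (hmain _ (mul_mem (fixingAbove_mono k.le_succ hsw) hσ) ?_)
    simpa [hσp] using hca
  · exact hmain σ hσ hσp

end Chain

end RegularTree

open RegularTree in
theorem mainTheorem8 (n : ℕ) :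
    ∃ (X : Type) (_ : Finite X) (_ : Nontrivial X) (G : Subgroup (RegularTree.TreeAut X)),
      RegularTree.IsBranch G ∧
      ∃ C : Fin (n + 1) → Subgroup (RegularTree.TreeAut X),
        C (Fin.last n) = G ∧
        ∀ i : Fin n,
          RegularTree.IsBranch (C i.castSucc) ∧
          C i.castSucc ≤ C i.succ ∧
          IsCoatom ((C i.castSucc).subgroupOf (C i.succ)) ∧
          ¬ ((C i.castSucc).subgroupOf (C i.succ)).FiniteIndex := by
  -- The shift by 2 starts the chain at `Sym(2)`, the first degree where the generation lemma
  -- applies.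
  refine ⟨Fin (n + 2), inferInstance, inferInstance,
    almostLetterwise (fixingAbove (n + 2) (n + 2)), isBranch_almostLetterwise _,
    fun i => almostLetterwise (fixingAbove (n + 2) (i + 2)), rfl, fun i => ?_⟩
  have hle : fixingAbove (n + 2) (i + 2) ≤ fixingAbove (n + 2) (i + 2 + 1) :=
    fixingAbove_mono (Nat.le_succ _)
  have hlt : (i : ℕ) + 2 < n + 2 := by omega
  have hsw : Equiv.swap (0 : Fin (n + 2)) ⟨i + 2, hlt⟩ ∈ fixingAbove (n + 2) (i + 2 + 1) :=
    swap_mem_fixingAbove (by simp) (by simp)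
  have hsw' : Equiv.swap (0 : Fin (n + 2)) ⟨i + 2, hlt⟩ ∉ fixingAbove (n + 2) (i + 2) :=
    fun h => by
      have := h ⟨i + 2, hlt⟩ le_rfl
      rw [Equiv.swap_apply_right] at this
      simpa using congrArg Fin.val this
  have hinf := not_finiteIndex_almostLetterwise hsw hsw'
  have hidx : ((i.succ : Fin (n + 1)) : ℕ) + 2 = i + 2 + 1 := by simp
  simp only [Fin.val_castSucc, hidx]
  refine ⟨isBranch_almostLetterwise _, almostLetterwise_mono hle, ?_, hinf⟩
  refine isCoatom_almostLetterwise hle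
    (fun h hh hh' L hL hL' => fixingAbove_succ_le hlt (by omega) hh hh' hL hL') hinf
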